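/- Let $P$ be a probability distribution on $\mathcal X\times\mathbb R$ ($\mathcal X$ a measurable space), let $L$ be a loss that maps a function $\varphi:\mathcal X\to\mathbb R$ to a function $L\varphi:\mathcal X\times\mathbb R\to\mathbb R$, and write $Pg=\int g\,dP$. For each $n$ let a training sample of size $n$ and a validation sample of size $\tilde n=\tilde n(n)$ be given, all observations being independent with law $P$, with empirical measures $P_n$ and $\tilde P_n$, and suppose that $n=O(\tilde n)$. Let $\mathcal F$ be a class of functions $\mathcal X\to\mathbb R$ that is Donsker for the marginal of $P$ on $\mathcal X$ and such that $\{L\varphi:\varphi\in\mathcal F\}$ is $P$-Donsker. (A class $\mathcal M$ of measurable square-integrable functions is $P$-Donsker if $\sup_{g\in\mathcal M}|g(z)-Pg|<\infty$ for every $z$ and $\sqrt n(P_n-P)$ converges weakly in $\ell^\infty(\mathcal M)$, in the sense of outer expectations, to a tight centered Gaussian process with covariance $P(gg')-Pg\,Pg'$.) For each $n$ let $\mathcal F_{1,n}\subseteq\mathcal F_{2,n}\subseteq\dots\subseteq\mathcal F_{K_n,n}\subseteq\mathcal F$, $K_n\ge 1$, be a nested sequence of function classes; the classes and their number $K_n$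 may be random and may depend on the data in an arbitrary way. Suppose that for each $1\le k\le K_n$ there is an empirical minimizer $f_{k,n}\in\operatorname{argmin}_{\varphi\in\mathcal F_{k,n}}P_nL\varphi$, and that there is a true minimizer $f\in\operatorname{argmin}_{\varphi\in\mathcal F}PL\varphi$. Put $\Delta_{k,n}=\tilde P_nLf_{k+1,n}-\tilde P_nLf_{k,n}$ for $1\le k<K_n$. Let $\varepsilon_n>0$ satisfy $\sqrt n\,\varepsilon_n\to\infty$, and let $k_n^*$ be the smallest $k$ with $1\le k<K_n$ and $\Delta_{k,n}>\varepsilon_n$, or $k_n^*=K_n$ if there is no such $k$. Let $r_n\to0$. If $P(Lf_{K_n,n}-Lf)=o_P(r_n)$, then $P(Lf_{k_n^*,n}-Lf)=o_P(r_n)$. Here $P(Lf_{k,n}-Lf)$ is the integral with the random function $f_{k,n}$ held fixed, and outer probability is used in $o_P$ for events that are not measurable. -/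

import Mathlib

open MeasureTheory ProbabilityTheory Filter Topology
open scoped ENNReal BoundedContinuousFunction

namespace EarlyStopping

/-- The empirical mean `(1/n) ∑ g(zᵢ)` of the function `g` over the sample `z`. -/
noncomputable def empMean {S : Type*} {n : ℕ} (z : Fin n → S) (g : S → ℝ) : ℝ :=
  (∑ i, g (z i)) / n

/-- The empirical process `√n (Pₙ - P) g`. -/
noncomputable def empProcess {S : Type*} [MeasurableSpace S] (P : Measure S) {n : ℕ}
    (z : Fin n → S) (g : S → ℝ) : ℝ :=
  √n * (empMean z g - ∫ s, g s ∂P)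

/-- The space `ℓ^∞(M)` of bounded real functions on the index class `M`, with the sup norm. -/
abbrev LInf {S : Type*} (M : Set (S → ℝ)) : Type _ := lp (fun _ : M => ℝ) ∞

/-- `sup_{g ∈ M} |g(s) - P g| < ∞` for every point `s`: the condition under which the sample
paths of the empirical process indexed by `M` are bounded. -/
def PointwiseBounded {S : Type*} [MeasurableSpace S] (P : Measure S) (M : Set (S → ℝ)) : Prop :=
  ∀ s, ∃ C : ℝ, ∀ g ∈ M, |g s - ∫ t, g t ∂P| ≤ C

theorem empProcess_memLInf {S : Type*} [MeasurableSpace S] {P : Measure S} {M : Set (S → ℝ)}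
    (hM : PointwiseBounded P M) {n : ℕ} (z : Fin n → S) :
    Memℓp (fun g : M => empProcess P z g) ∞ := by
  choose C hC using hM
  refine memℓp_infty ⟨√n * ((∑ i, C (z i)) / n), ?_⟩
  rintro _ ⟨g, rfl⟩
  rcases Nat.eq_zero_or_pos n with rfl | hn
  · simp [empProcess]
  have hn' : (0 : ℝ) < n := by exact_mod_cast hn
  have h1 : empMean z (g : S → ℝ) - ∫ s, (g : S → ℝ) s ∂P
      = (∑ i, ((g : S → ℝ) (z i) - ∫ s, (g : S → ℝ) s ∂P)) / n := by
    rw [Finset.sum_sub_distrib, empMean]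
    simp only [Finset.sum_const, Finset.card_univ, Fintype.card_fin, nsmul_eq_mul]
    field_simp
  simp only [empProcess, Real.norm_eq_abs]
  rw [abs_mul, abs_of_nonneg (Real.sqrt_nonneg _), h1, abs_div, abs_of_pos hn']
  gcongr
  exact (Finset.abs_sum_le_sum_abs _ _).trans (Finset.sum_le_sum fun i _ => hC _ _ g.2)

/-- The empirical process as a map from samples of size `n` to `ℓ^∞(M)`. -/
noncomputable def empPath {S : Type*} [MeasurableSpace S] {P : Measure S} {M : Set (S → ℝ)}
    (hM : PointwiseBounded P M) {n : ℕ} (z : Fin n → S) : LInf M :=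
  ⟨fun g => empProcess P z g, empProcess_memLInf hM z⟩

/-- The outer expectation `E* T` of a bounded, possibly non-measurable, real function `T`:
the infimum of `E U` over the integrable measurable `U ≥ T`. -/
noncomputable def outerExpectation {S : Type*} [MeasurableSpace S] (Q : Measure S)
    (T : S → ℝ) : ℝ :=
  sInf {a | ∃ U : S → ℝ, Measurable U ∧ Integrable U Q ∧ (∀ s, T s ≤ U s) ∧ a = ∫ s, U s ∂Q}

/-- `ν`, a Borel law on `ℓ^∞(M)`, is the law of a tight `P`-Brownian bridge indexed by `M`:
a tight centered Gaussian process with covariance `P(g g') - P g P g'`. -/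
def IsTightBridge {S : Type*} [MeasurableSpace S] (P : Measure S) (M : Set (S → ℝ))
    (ν : @Measure (LInf M) (borel (LInf M))) : Prop :=
  letI : MeasurableSpace (LInf M) := borel (LInf M)
  IsProbabilityMeasure ν ∧ IsTightMeasureSet {ν} ∧
    IsGaussianProcess (fun (g : M) (x : LInf M) => x g) ν ∧
    (∀ g : M, ∫ x : LInf M, x g ∂ν = 0) ∧
    ∀ g g' : M, ∫ x : LInf M, x g * x g' ∂ν =
      (∫ s, (g : S → ℝ) s * (g' : S → ℝ) s ∂P) -
        (∫ s, (g : S → ℝ) s ∂P) * ∫ s, (g' : S → ℝ) s ∂P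

/-- `M` is a `P`-Donsker class: it consists of measurable square-integrable functions, the
empirical process of an i.i.d. sample from `P` has bounded sample paths on `M`, and it converges
weakly in `ℓ^∞(M)` (in the sense of outer expectations of bounded continuous functionals, the
sample being that of the coordinates of `Sⁿ` under `Pⁿ`) to a tight Gaussian process. -/
def IsDonsker {S : Type*} [MeasurableSpace S] (P : Measure S) (M : Set (S → ℝ)) : Prop :=
  (∀ g ∈ M, Measurable g ∧ MemLp g 2 P) ∧
  ∃ hM : PointwiseBounded P M, ∃ ν : @Measure (LInf M) (borel (LInf M)),
    IsTightBridge P M ν ∧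
    ∀ h : LInf M →ᵇ ℝ,
      Tendsto
        (fun n : ℕ => outerExpectation (Measure.pi fun _ : Fin n => P)
          (fun z => h (empPath hM z)))
        atTop (𝓝 (@integral (LInf M) ℝ _ _ (borel (LInf M)) ν fun x => h x))

/-- `Xₙ = o_P(rₙ)`. Sets that are not measurable are measured by the outer measure. -/
def IsLittleOP {Ω : Type*} [MeasurableSpace Ω] (μ : Measure Ω) (X : ℕ → Ω → ℝ)
    (r : ℕ → ℝ) : Prop :=
  ∀ δ : ℝ, 0 < δ → Tendsto (fun n => μ {ω | δ * |r n| < |X n ω|}) atTop (𝓝 0)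

/-- `φ` is a minimizer of the criterion `R` over the class `A`. -/
def IsArgmin {α : Type*} (R : α → ℝ) (A : Set α) (φ : α) : Prop :=
  φ ∈ A ∧ ∀ ψ ∈ A, R φ ≤ R ψ

/-- The early-stopping index for the increments `Δ 1, …, Δ (K - 1)`: the smallest `k` with
`Δ k > ε`, and the final index `K` when no increment exceeds `ε`. -/
noncomputable def stopIndex (K : ℕ) (Δ : ℕ → ℝ) (ε : ℝ) : ℕ :=
  sInf ({k | 1 ≤ k ∧ k < K ∧ ε < Δ k} ∪ {K})

end EarlyStopping

/-!
The whole argument is that stopping strictly before `K n` has outer probability tending to zero, so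
that the two excess risks agree with probability tending to one.

Since the classes are nested, the training criterion is nonincreasing in `k`, i.e.
`Pₙ L f̂_{k+1} ≤ Pₙ L f̂_k`. A validation increment `Δ k > ε` therefore forces
`ε < (P̃ₙ - Pₙ)(L f̂_{k+1} - L f̂_k)`, which is at most
`2 sup |(Pₙ - P) g| + 2 sup |(P̃ₙ - P) g|` over `g ∈ L '' 𝓕`
(`sqrt_mul_lt_of_increment`). Both suprema are `O_P(n^{-1/2})`, the second one because
`n = O(m n)`, whereas `√n ε n → ∞`. As the suprema run over the whole fixed class `L '' 𝓕`, the
arbitrary dependence of the random classes on the data is harmless.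

The `O_P` bound is `IsDonsker.outer_tight`: weak convergence applied to the bounded continuous
functional `ramp R x = min 1 (‖x‖ - R)⁺` bounds the outer expectation of `ramp R` by a number
close to its integral under the limit law, which is small for large `R`; Markov's inequality for
outer expectations (`measure_one_le_le_of_outerExpectation_lt`) turns this into a bound for outer
probabilities.
-/

namespace EarlyStopping

/-! ### Outer tightness of the empirical process -/

/-- Markov's inequality for outer expectations: the set where `T ≥ 1` need not be measurable. -/
theorem measure_one_le_le_of_outerExpectation_lt {S : Type*} [MeasurableSpace S] {Q : Measure S}
    [IsFiniteMeasure Q] {T : S → ℝ} (h0 : ∀ s, 0 ≤ T s) {C : ℝ} (hC : ∀ s, T s ≤ C) {a : ℝ}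
    (h : outerExpectation Q T < a) : Q {s | 1 ≤ T s} ≤ ENNReal.ofReal a := by
  have hne : {a | ∃ U : S → ℝ, Measurable U ∧ Integrable U Q ∧ (∀ s, T s ≤ U s) ∧
      a = ∫ s, U s ∂Q}.Nonempty :=
    ⟨_, fun _ => C, measurable_const, integrable_const _, hC, rfl⟩
  obtain ⟨_, ⟨U, -, hUi, hTU, rfl⟩, hlt⟩ := exists_lt_of_csInf_lt hne h
  have hU0 : 0 ≤ᵐ[Q] U := .of_forall fun s => (h0 s).trans (hTU s)
  have hmarkov := mul_meas_ge_le_integral_of_nonneg hU0 hUi 1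
  rw [one_mul] at hmarkov
  calc Q {s | 1 ≤ T s} ≤ Q {s | 1 ≤ U s} := measure_mono fun s hs => le_trans hs (hTU s)
    _ = ENNReal.ofReal (Q.real {s | 1 ≤ U s}) := (ofReal_measureReal).symm
    _ ≤ ENNReal.ofReal a := ENNReal.ofReal_le_ofReal (hmarkov.trans hlt.le)

/-- The bounded continuous functional `x ↦ min 1 (‖x‖ - R)⁺`, which vanishes on the ball of radius
`R` and equals `1` outside the ball of radius `R + 1`. -/
noncomputable def ramp (E : Type*) [NormedAddCommGroup E] (R : ℝ) : E →ᵇ ℝ :=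
  BoundedContinuousFunction.ofNormedAddCommGroup (fun x => min 1 (max 0 (‖x‖ - R)))
    (by fun_prop) 1 fun x => by
      rw [Real.norm_eq_abs, abs_of_nonneg (by positivity)]
      exact min_le_left _ _

theorem ramp_apply {E : Type*} [NormedAddCommGroup E] (R : ℝ) (x : E) :
    ramp E R x = min 1 (max 0 (‖x‖ - R)) := rfl

theorem ramp_nonneg {E : Type*} [NormedAddCommGroup E] (R : ℝ) (x : E) : 0 ≤ ramp E R x := by
  rw [ramp_apply]; positivity

theorem ramp_le_one {E : Type*} [NormedAddCommGroup E] (R : ℝ) (x : E) : ramp E R x ≤ 1 :=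
  min_le_left _ _

theorem one_le_ramp {E : Type*} [NormedAddCommGroup E] {R : ℝ} {x : E} (h : R + 1 ≤ ‖x‖) :
    1 ≤ ramp E R x :=
  le_min le_rfl (le_max_of_le_right (by linarith))

theorem tendsto_integral_ramp {E : Type*} [NormedAddCommGroup E] [MeasurableSpace E]
    [OpensMeasurableSpace E] (ν : Measure E) [IsFiniteMeasure ν] :
    Tendsto (fun k : ℕ => ∫ x, ramp E k x ∂ν) atTop (𝓝 0) := by
  rw [← integral_zero E ℝ (μ := ν)]
  refine tendsto_integral_of_dominated_convergence (fun _ => 1)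
    (fun k => (ramp E k).continuous.measurable.aestronglyMeasurable) (integrable_const _)
    (fun k => .of_forall fun x => ?_) (.of_forall fun x => ?_)
  · rw [Real.norm_eq_abs, abs_of_nonneg (ramp_nonneg _ _)]
    exact ramp_le_one _ _
  · refine tendsto_const_nhds.congr' ?_
    filter_upwards [eventually_ge_atTop ⌈‖x‖⌉₊] with k hk
    have hxk : ‖x‖ ≤ k := (Nat.le_ceil _).trans (by exact_mod_cast hk)
    rw [ramp_apply, max_eq_left (by linarith), min_eq_right zero_le_one]

/-- The supremum over a Donsker class of the empirical process is bounded in outer probability. -/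
theorem IsDonsker.outer_tight {S : Type*} [MeasurableSpace S] {P : Measure S}
    [IsProbabilityMeasure P] {M : Set (S → ℝ)} (hM : IsDonsker P M) {η : ℝ≥0∞} (hη : 0 < η) :
    ∃ R : ℝ, ∀ᶠ n : ℕ in atTop,
      (Measure.pi fun _ : Fin n => P) {z | ∃ g ∈ M, R < |(empProcess P z g)|} ≤ η := by
  obtain ⟨-, hb, ν, ⟨hν, -⟩, hconv⟩ := hM
  let _ : MeasurableSpace (LInf M) := borel (LInf M)
  have : BorelSpace (LInf M) := ⟨rfl⟩
  obtain ⟨a, ha0, haη⟩ := ENNReal.lt_iff_exists_nnreal_btwn.1 hη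
  have ha : (0 : ℝ) < a := by exact_mod_cast ha0
  obtain ⟨k, hk⟩ := ((tendsto_integral_ramp ν).eventually_lt_const ha).exists
  refine ⟨k + 1, ?_⟩
  filter_upwards [(hconv (ramp _ k)).eventually_lt_const hk] with n hn
  have hle := measure_one_le_le_of_outerExpectation_lt (fun z => ramp_nonneg _ _)
    (fun z => ramp_le_one _ _) hn
  rw [ENNReal.ofReal_coe_nnreal] at hle
  refine (measure_mono ?_).trans (hle.trans haη.le)
  rintro z ⟨g, hg, hlt⟩
  exact one_le_ramp (hlt.le.trans
    (lp.norm_apply_le_norm ENNReal.top_ne_zero (empPath hb z) ⟨g, hg⟩))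

/-- An i.i.d. sample on any probability space inherits bounds on outer probabilities from the
coordinate sample. -/
theorem measure_sample_le {Ω S : Type*} [MeasurableSpace Ω] [MeasurableSpace S] {μ : Measure Ω}
    {P : Measure S} {n : ℕ} {Z : Fin n → Ω → S} (hZ : ∀ i, HasLaw (Z i) P μ)
    (hind : iIndepFun Z μ) (A : Set (Fin n → S)) :
    μ {ω | (fun i => Z i ω) ∈ A} ≤ (Measure.pi fun _ : Fin n => P) A := by
  have hlaw := hind.hasLaw_pi hZ
  rw [← hlaw.map_eq]
  exact Measure.le_map_apply hlaw.aemeasurable A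

/-! ### The stopping index -/

theorem stopIndex_spec {K : ℕ} {Δ : ℕ → ℝ} {ε : ℝ} (h : stopIndex K Δ ε ≠ K) :
    1 ≤ stopIndex K Δ ε ∧ stopIndex K Δ ε < K ∧ ε < Δ (stopIndex K Δ ε) :=
  (Nat.sInf_mem (s := {k | 1 ≤ k ∧ k < K ∧ ε < Δ k} ∪ {K}) ⟨K, .inr rfl⟩).resolve_right h

/-- If the training mean does not increase from `g` to `g'` but the validation mean increases by
more than `ε`, then `√n ε` is bounded by bounds on the two empirical processes at `g` and `g'`. -/
theorem sqrt_mul_lt_of_increment {S : Type*} [MeasurableSpace S] {P : Measure S} {n m : ℕ}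
    {z : Fin n → S} {v : Fin m → S} {g g' : S → ℝ} {ε R R' C : ℝ} (hn : 0 < n)
    (hC : (n : ℝ) ≤ C * m)
    (hg : |(empProcess P z g)| ≤ R) (hg' : |(empProcess P z g')| ≤ R)
    (hvg : |(empProcess P v g)| ≤ R') (hvg' : |(empProcess P v g')| ≤ R')
    (htrain : empMean z g' ≤ empMean z g) (hval : ε < empMean v g' - empMean v g) :
    √n * ε < 2 * R + √C * (2 * R') := by
  have hn' : (0 : ℝ) < √n := Real.sqrt_pos.2 (by exact_mod_cast hn)
  have hnm : √n ≤ √C * √m := by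
    rw [← Real.sqrt_mul' C (Nat.cast_nonneg m)]
    exact Real.sqrt_le_sqrt hC
  simp only [empProcess, abs_le] at hg hg' hvg hvg'
  set a := empMean v g' - ∫ s, g' s ∂P
  set b := empMean v g - ∫ s, g s ∂P
  have hab : √n * (a - b) ≤ √C * (2 * R') := by
    have hR' : 0 ≤ R' := by linarith
    rcases le_total (a - b) 0 with h | h
    · exact (mul_nonpos_of_nonneg_of_nonpos hn'.le h).trans (by positivity)
    · calc √n * (a - b) ≤ √C * √m * (a - b) := by gcongr
        _ = √C * (√m * a - √m * b) := by ring
        _ ≤ √C * (2 * R') := by gcongr; linarith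
  have hε := mul_lt_mul_of_pos_left hval hn'
  have ht := mul_le_mul_of_nonneg_left htrain hn'.le
  have hsplit : √n * (empMean v g' - empMean v g) = √n * (a - b)
      + (√n * ((∫ s, g' s ∂P) - ∫ s, g s ∂P)) := by simp only [a, b]; ring
  linarith

end EarlyStopping

theorem theorem1 {𝒳 Ω : Type*} [MeasurableSpace 𝒳] [MeasurableSpace Ω]
    -- the probability space, the law of an observation `(X, Y)`, and the loss
    (μ : Measure Ω) [IsProbabilityMeasure μ]
    (P : Measure (𝒳 × ℝ)) [IsProbabilityMeasure P]
    (L : (𝒳 → ℝ) → 𝒳 × ℝ → ℝ)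
    -- the parent class and its image under the loss are Donsker
    (𝓕 : Set (𝒳 → ℝ))
    (hF : EarlyStopping.IsDonsker (P.map Prod.fst) 𝓕)
    (hLF : EarlyStopping.IsDonsker P (L '' 𝓕))
    -- training sample of size `n`, independent validation sample of size `m n ≥ c n`
    (m : ℕ → ℕ) (hm : (fun n : ℕ => (n : ℝ)) =O[atTop] fun n => (m n : ℝ))
    (Z : (n : ℕ) → Fin n → Ω → 𝒳 × ℝ)
    (Zv : (n : ℕ) → Fin (m n) → Ω → 𝒳 × ℝ)
    (hZ : ∀ n i, HasLaw (Z n i) P μ) (hZv : ∀ n i, HasLaw (Zv n i) P μ)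
    (hind : ∀ n, iIndepFun (fun i : Fin n ⊕ Fin (m n) => Sum.elim (Z n) (Zv n) i) μ)
    -- the random nested classes `F n 1 ω ⊆ ⋯ ⊆ F n (K n ω) ω ⊆ 𝓕`
    (K : ℕ → Ω → ℕ) (hK : ∀ n ω, 1 ≤ K n ω)
    (F : ℕ → ℕ → Ω → Set (𝒳 → ℝ))
    (hnested : ∀ n ω k, 1 ≤ k → k < K n ω → F n k ω ⊆ F n (k + 1) ω)
    (hparent : ∀ n ω k, 1 ≤ k → k ≤ K n ω → F n k ω ⊆ 𝓕)
    -- the empirical minimizers and the true minimizer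
    (fhat : ℕ → ℕ → Ω → 𝒳 → ℝ)
    (hfhat : ∀ n ω k, 1 ≤ k → k ≤ K n ω →
      EarlyStopping.IsArgmin
        (fun φ => EarlyStopping.empMean (fun i => Z n i ω) (L φ)) (F n k ω) (fhat n k ω))
    (f : 𝒳 → ℝ)
    (hf : EarlyStopping.IsArgmin (fun φ => ∫ s, L φ s ∂P) 𝓕 f)
    -- the threshold, shrinking more slowly than `n ^ (-1/2)` if at all
    (ε : ℕ → ℝ) (hε : ∀ n, 0 < ε n) (hεn : Tendsto (fun n : ℕ => √n * ε n) atTop atTop)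
    -- the validation increments and the stopping index
    (Δ : ℕ → ℕ → Ω → ℝ)
    (hΔ : ∀ n k ω, Δ n k ω =
      EarlyStopping.empMean (fun i => Zv n i ω) (L (fhat n (k + 1) ω)) -
        EarlyStopping.empMean (fun i => Zv n i ω) (L (fhat n k ω)))
    (kstar : ℕ → Ω → ℕ)
    (hkstar : ∀ n ω, kstar n ω = EarlyStopping.stopIndex (K n ω) (fun k => Δ n k ω) (ε n))
    -- the rate
    (r : ℕ → ℝ) (hr : Tendsto r atTop (𝓝 0))
    (hrate : EarlyStopping.IsLittleOP μ
      (fun n ω => ∫ s, (L (fhat n (K n ω) ω) s - L f s) ∂P) r) :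
    EarlyStopping.IsLittleOP μ
      (fun n ω => ∫ s, (L (fhat n (kstar n ω) ω) s - L f s) ∂P) r := by
  -- The outer probability of stopping early tends to zero.
  open EarlyStopping in
  have stop_zero : Tendsto (fun n => μ {ω | kstar n ω ≠ K n ω}) atTop (𝓝 0) := by
    rw [ENNReal.tendsto_nhds_zero]
    intro η hη
    obtain ⟨R, hR⟩ := hLF.outer_tight (ENNReal.half_pos hη.ne')
    obtain ⟨C, hC0, hC⟩ := hm.exists_pos
    have hC' : ∀ᶠ n : ℕ in atTop, (n : ℝ) ≤ C * m n := by simpa using hC.bound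
    have hmtop : Tendsto m atTop atTop := by
      rw [← tendsto_natCast_atTop_iff (R := ℝ), ← tendsto_const_mul_atTop_of_pos hC0]
      exact tendsto_atTop_mono' _ hC' tendsto_natCast_atTop_atTop
    filter_upwards [hR, hmtop.eventually hR, hC', eventually_gt_atTop 0,
      hεn.eventually_ge_atTop (2 * R + √C * (2 * R))] with n hn hmn hCn hn0 hεR
    have htrain := measure_sample_le (hZ n) ((hind n).precomp (g := Sum.inl) Sum.inl_injective)
      {z | ∃ g ∈ L '' 𝓕, R < |(empProcess P z g)|}
    have hval := measure_sample_le (hZv n) ((hind n).precomp (g := Sum.inr) Sum.inr_injective)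
      {z | ∃ g ∈ L '' 𝓕, R < |(empProcess P z g)|}
    refine le_trans (measure_mono fun ω hω => ?_) ((measure_union_le _ _).trans
      ((add_le_add (htrain.trans hn) (hval.trans hmn)).trans (ENNReal.add_halves η).le))
    by_contra hnot
    simp only [Set.mem_union, Set.mem_ofPred_eq, not_or, not_exists, not_and, not_lt] at hnot
    obtain ⟨hzle, hvle⟩ := hnot
    rw [Set.mem_ofPred_eq, hkstar] at hω
    obtain ⟨h1, hlt, hinc⟩ := stopIndex_spec hω
    set k := stopIndex (K n ω) (fun k => Δ n k ω) (ε n)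
    rw [hΔ] at hinc
    have hk := hfhat n ω k h1 hlt.le
    have hk' := hfhat n ω (k + 1) (by omega) hlt
    have hmem := Set.mem_image_of_mem L (hparent n ω k h1 hlt.le hk.1)
    have hmem' := Set.mem_image_of_mem L (hparent n ω (k + 1) (by omega) hlt hk'.1)
    exact hεR.not_gt (sqrt_mul_lt_of_increment hn0 hCn (hzle _ hmem) (hzle _ hmem') (hvle _ hmem)
      (hvle _ hmem') (hk'.2 _ (hnested n ω k h1 hlt hk.1)) hinc)
  intro δ hδ
  refine tendsto_of_tendsto_of_tendsto_of_le_of_le tendsto_const_nhds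
    (by simpa using stop_zero.add (hrate δ hδ)) (fun _ => zero_le) fun n => ?_
  refine (measure_mono fun ω hω => ?_).trans (measure_union_le _ _)
  rcases ne_or_eq (kstar n ω) (K n ω) with h | h
  · exact .inl h
  · right
    simpa only [Set.mem_ofPred_eq, h] using hω
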